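/- Let $f:\mathbb{R}^p\to\mathbb{R}\cup\{+\infty\}$ and $g:\mathbb{R}^n\to\mathbb{R}\cup\{+\infty\}$ be proper, closed and convex, let $K:\mathbb{R}^p\to\mathbb{R}^n$ be linear with $K\neq 0$, and let $\|\cdot\|$ be the Euclidean norm (the operator norm for $K$). Let $h^*(v)=\sup_u\{\langle v,u\rangle-h(u)\}$ denote the Fenchel conjugate and put $$\mathcal{L}(x,y)=f(x)+\langle Kx,y\rangle-g^*(y),\quad F(x)=f(x)+g(Kx),\quad D(y)=f^*(-K^\top y)+g^*(y),\quad F^\star=\inf_x F(x),\quad D^\star=\inf_y D(y).$$ Assume that $0\in\mathrm{ri}(\mathrm{dom}\,g-K\,\mathrm{dom}\,f)$ and that $\mathcal{L}$ has a saddle point, i.e. a pair $(x^\star,y^\star)\in\mathrm{dom}\,f\times\mathrm{dom}\,g^*$ with $\mathcal{L}(x^\star,y)\le\mathcal{L}(x^\star,y^\star)\le\mathcal{L}(x,y^\star)$ for all $(x,y)\in\mathrm{dom}\,f\times\mathrm{dom}\,g^*$. For $\gamma>0$, $\mathrm{prox}_{\gamma h}(u)$ is the minimizer of $h(w)+\frac{1}{2\gamma}\|w-u\|^2$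 over $w$. A proper closed convex function $h$ is called $M$-Lipschitz on $\mathrm{dom}\,h$ (where $M\ge 0$) if $|h(u)-h(v)|\le M\|u-v\|$ for all $u,v\in\mathrm{dom}\,h$ and every subgradient of $h$ at every point of $\mathrm{dom}\,h$ has norm at most $M$ (together this means that $h$ is finite and $M$-Lipschitz on the whole space). For every $t\in(0,1]$ the equation $\tau^3+\tau^2+t^2\tau-t^2=0$ has exactly one root $\tau\in(0,1)$. Let $\tau_0=1$ and let $\tau_{k+1}\in(0,1)$ be this root for $t=\tau_k$. Let $x^0\in\mathrm{dom}\,f$, $\tilde y^0\in\mathrm{dom}\,g^*$, $\dot y\in\mathbb{R}^n$, $\beta_0>0$, $\hat x^0=x^0$, and let the iterates of ASGARD+ in the general convex case ($\mu_f=\mu_{g^*}=0$) be given, for $k\ge 0$, by $$\beta_{k+1}=\frac{\beta_k}{1+\tau_{k+1}},\qquad L_k=\frac{\|K\|^2}{\beta_k},\qquad m_{k+1}=\frac{L_{k+1}}{L_k},\qquad \eta_{k+1}=\frac{(1-\tau_k)\tau_k}{\tau_k^2+m_{k+1}\tau_{k+1}},$$ $$y^{k+1}=\mathrm{prox}_{g^*/\beta_k}\big(\dot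 y+\tfrac{1}{\beta_k}K\hat x^k\big),\qquad x^{k+1}=\mathrm{prox}_{f/L_k}\big(\hat x^k-\tfrac{1}{L_k}K^\top y^{k+1}\big),$$ $$\hat x^{k+1}=x^{k+1}+\eta_{k+1}(x^{k+1}-x^k),\qquad \tilde y^{k+1}=(1-\tau_k)\tilde y^k+\tau_k y^{k+1}.$$ Then for all $k\ge 1$: (a) For all nonempty closed convex sets $\mathcal{X}\subseteq\mathrm{dom}\,f$ and $\mathcal{Y}\subseteq\mathrm{dom}\,g^*$ such that $\mathcal{X}\times\mathcal{Y}$ contains a saddle point of $\mathcal{L}$, the gap function $\mathcal{G}_{\mathcal{X}\times\mathcal{Y}}(x,y)=\sup\{\mathcal{L}(x,\tilde y)-\mathcal{L}(\tilde x,y):\tilde x\in\mathcal{X},\tilde y\in\mathcal{Y}\}$ satisfies $$\mathcal{G}_{\mathcal{X}\times\mathcal{Y}}(x^k,\tilde y^k)\le\frac{\|K\|^2}{2\beta_0k}\sup_{x\in\mathcal{X}}\|x^0-x\|^2+\frac{\beta_0}{k+1}\sup_{y\in\mathcal{Y}}\|y-\dot y\|^2,$$ where the suprema may be $+\infty$.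 (b) If $g$ is $M_g$-Lipschitz on $\mathrm{dom}\,g$, then for every saddle point $(x^\star,y^\star)$ $$F(x^k)-F^\star\le\frac{\|K\|^2}{2\beta_0k}\|x^0-x^\star\|^2+\frac{\beta_0}{k+1}\big(\|\dot y\|+M_g\big)^2.$$ (c) If $f^*$ is $M_{f^*}$-Lipschitz on $\mathrm{dom}\,f^*$, then for every saddle point $(x^\star,y^\star)$ $$D(\tilde y^k)-D^\star\le\frac{\|K\|^2}{2\beta_0k}\big(\|x^0\|+M_{f^*}\big)^2+\frac{\beta_0}{k+1}\|\dot y-y^\star\|^2.$$ -/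

import Mathlib

noncomputable section

namespace ASGARD

/-- The Euclidean space of dimension `d`. -/
abbrev Euc (d : ℕ) : Type := EuclideanSpace ℝ (Fin d)

/-- The effective domain of an extended-real-valued function. -/
def dom {d : ℕ} (h : Euc d → EReal) : Set (Euc d) := {u | h u < ⊤}

/-- `h` takes values in `ℝ ∪ {+∞}` and is proper, closed and convex
(its epigraph is closed and convex). -/
structure ProperClosedConvex {d : ℕ} (h : Euc d → EReal) : Prop where
  ne_bot : ∀ u, h u ≠ ⊥
  dom_nonempty : (dom h).Nonempty
  isClosed_epi : IsClosed {q : Euc d × ℝ | h q.1 ≤ (q.2 : EReal)}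
  convex_epi : Convex ℝ {q : Euc d × ℝ | h q.1 ≤ (q.2 : EReal)}

/-- The Fenchel conjugate `h*(v) = sup_u (⟨v, u⟩ - h(u))`. -/
def conj {d : ℕ} (h : Euc d → EReal) (v : Euc d) : EReal :=
  ⨆ u : Euc d, ((inner ℝ v u : ℝ) : EReal) - h u

/-- The convex subdifferential of `h` at `u` (empty outside the domain). -/
def subdiff {d : ℕ} (h : Euc d → EReal) (u : Euc d) : Set (Euc d) :=
  {v | u ∈ dom h ∧ ∀ w : Euc d, h u + ((inner ℝ v (w - u) : ℝ) : EReal) ≤ h w}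

/-- `M`-Lipschitz continuity of a convex function on its domain: the Lipschitz inequality holds on
the domain and the subdifferential is uniformly bounded by `M` there. -/
structure LipschitzOnDom {d : ℕ} (M : ℝ) (h : Euc d → EReal) : Prop where
  nonneg : 0 ≤ M
  abs_sub_le : ∀ u ∈ dom h, ∀ v ∈ dom h, |(h u).toReal - (h v).toReal| ≤ M * ‖u - v‖
  norm_subgradient_le : ∀ u ∈ dom h, ∀ v ∈ subdiff h u, ‖v‖ ≤ M

/-- `z = prox_{γ h}(u)`: the point `z` minimizes `h(w) + ‖w - u‖² / (2 γ)` over all `w`. -/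
def IsProx {d : ℕ} (γ : ℝ) (h : Euc d → EReal) (u z : Euc d) : Prop :=
  z ∈ dom h ∧ ∀ w : Euc d,
    h z + ((1 / (2 * γ) * ‖z - u‖ ^ 2 : ℝ) : EReal) ≤
      h w + ((1 / (2 * γ) * ‖w - u‖ ^ 2 : ℝ) : EReal)

section Problem

variable {p n : ℕ} (f : Euc p → EReal) (g : Euc n → EReal) (K : Euc p →L[ℝ] Euc n)

/-- The Lagrangian `ℒ(x, y) = f(x) + ⟨K x, y⟩ - g*(y)`; only used on `dom f × dom g*`. -/
def lagrangian (x : Euc p) (y : Euc n) : EReal :=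
  f x + ((inner ℝ (K x) y : ℝ) : EReal) - conj g y

/-- The primal objective `F(x) = f(x) + g(K x)`. -/
def primal (x : Euc p) : EReal := f x + g (K x)

/-- The primal optimal value `F⋆`. -/
def primalOpt : EReal := ⨅ x : Euc p, primal f g K x

/-- The dual objective `D(y) = f*(-Kᵀ y) + g*(y)`. -/
def dual (y : Euc n) : EReal := conj f (-(K.adjoint y)) + conj g y

/-- The dual optimal value `D⋆`. -/
def dualOpt : EReal := ⨅ y : Euc n, dual f g K y

/-- `(xs, ys)` is a saddle point of the Lagrangian. -/
structure IsSaddlePoint (xs : Euc p) (ys : Euc n) : Prop where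
  mem_dom_left : xs ∈ dom f
  mem_dom_right : ys ∈ dom (conj g)
  le_right : ∀ y ∈ dom (conj g), lagrangian f g K xs y ≤ lagrangian f g K xs ys
  le_left : ∀ x ∈ dom f, lagrangian f g K xs ys ≤ lagrangian f g K x ys

/-- The gap function
`𝒢(x, y) = sup {ℒ(x, y') - ℒ(x', y) : x' ∈ X, y' ∈ Y}`. -/
def gap (X : Set (Euc p)) (Y : Set (Euc n)) (x : Euc p) (y : Euc n) : EReal :=
  ⨆ x' ∈ X, ⨆ y' ∈ Y, lagrangian f g K x y' - lagrangian f g K x' y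

/-- The admissible pairs `X × Y` for the gap function. -/
structure IsGapDomain (X : Set (Euc p)) (Y : Set (Euc n)) : Prop where
  subset_dom_left : X ⊆ dom f
  subset_dom_right : Y ⊆ dom (conj g)
  nonempty_left : X.Nonempty
  nonempty_right : Y.Nonempty
  isClosed_left : IsClosed X
  isClosed_right : IsClosed Y
  convex_left : Convex ℝ X
  convex_right : Convex ℝ Y
  exists_saddle : ∃ xs ∈ X, ∃ ys ∈ Y, IsSaddlePoint f g K xs ys

end Problem

/-- The cubic polynomial `s³ + s² + t² s - t²` that determines `τ_{k+1} = s` from `τ_k = t`. -/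
def cubic (t s : ℝ) : ℝ := s ^ 3 + s ^ 2 + t ^ 2 * s - t ^ 2

/-- `τ_0 = 1`, and `τ_{k+1}` is the root in `(0, 1)` of the cubic determined by `τ_k`. -/
structure IsTauSeq (τ : ℕ → ℝ) : Prop where
  zero : τ 0 = 1
  succ_mem : ∀ k, τ (k + 1) ∈ Set.Ioo (0 : ℝ) 1
  succ_root : ∀ k, cubic (τ k) (τ (k + 1)) = 0

/-- The smoothness parameters: `β_{k+1} = β_k / (1 + τ_{k+1})`. -/
def betaSeq (β₀ : ℝ) (τ : ℕ → ℝ) : ℕ → ℝ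
  | 0 => β₀
  | k + 1 => betaSeq β₀ τ k / (1 + τ (k + 1))

section Algorithm

variable {p n : ℕ} (f : Euc p → EReal) (g : Euc n → EReal) (K : Euc p →L[ℝ] Euc n)
  (μf μg β₀ : ℝ) (τ : ℕ → ℝ)

/-- `L_k = ‖K‖² / (μ_{g*} + β_k)`. -/
def LSeq (k : ℕ) : ℝ := ‖K‖ ^ 2 / (μg + betaSeq β₀ τ k)

/-- `mSucc k` is `m_{k+1} = (L_{k+1} + μ_f) / (L_k + μ_f)`. -/
def mSucc (k : ℕ) : ℝ := (LSeq K μg β₀ τ (k + 1) + μf) / (LSeq K μg β₀ τ k + μf)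

/-- `etaSucc k` is `η_{k+1} = (1 - τ_k) τ_k / (τ_k² + m_{k+1} τ_{k+1})`. -/
def etaSucc (k : ℕ) : ℝ :=
  (1 - τ k) * τ k / (τ k ^ 2 + mSucc K μf μg β₀ τ k * τ (k + 1))

/-- The iterates `x^k, x̂^k, y^k, ỹ^k` are generated by ASGARD+ with strong convexity parameters
`μ_f, μ_{g*}`, initial smoothness parameter `β_0`, step parameters `τ_k` and proximal center `ydot`
(the value `y 0` plays no role). -/
structure IsASGARDPlus (ydot : Euc n) (x xhat : ℕ → Euc p) (y ytil : ℕ → Euc n) : Prop where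
  x_zero_mem : x 0 ∈ dom f
  ytil_zero_mem : ytil 0 ∈ dom (conj g)
  xhat_zero : xhat 0 = x 0
  y_succ : ∀ k, IsProx (1 / betaSeq β₀ τ k) (conj g)
    (ydot + (1 / betaSeq β₀ τ k) • K (xhat k)) (y (k + 1))
  x_succ : ∀ k, IsProx (1 / LSeq K μg β₀ τ k) f
    (xhat k - (1 / LSeq K μg β₀ τ k) • K.adjoint (y (k + 1))) (x (k + 1))
  xhat_succ : ∀ k, xhat (k + 1) = x (k + 1) + etaSucc K μf μg β₀ τ k • (x (k + 1) - x k)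
  ytil_succ : ∀ k, ytil (k + 1) = (1 - τ k) • ytil k + τ k • y (k + 1)

end Algorithm

end ASGARD

end

open ASGARD
open scoped Pointwise

/-! The proof follows one potential. Write `x^{k+1} = (1 - τ_k) x^k + τ_k x̃^{k+1}`; the momentum is
such that `x̂^k = (1 - τ_k) x^k + τ_k x̃^k`. For fixed `u` and any `v`, `accelerated_step` bounds
the smoothed gap `ℒ(x^{k+1}, v) - (β_k/2)‖v - ẏ‖² - ℒ(u, ỹ^{k+1})` plus `(L_k τ_k²/2)‖u -
x̃^{k+1}‖²`. Since `(1 + τ_k) β_k = β_{k-1}` and, by the cubic, `L_k τ_k² = (1 - τ_k) L_{k-1}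
τ_{k-1}²`, the bound is `1 - τ_k` times the previous potential at `v = y^{k+1}`. Induction gives
`potential_le`, and `τ_k ≥ 1/(k+1)` turns it into the rates of `lagrangian_gap_le`.

Taking suprema gives (a). For (b) and (c), bounded subgradients allow the supremum defining `g(K
x^k)` or `f*(-Kᵀ ỹ^k)` to be restricted to a ball (`le_of_forall_conj_le`, `conj_le_of_forall_le`).
The gap bound is then applied with the other variable at the saddle point, and weak duality compares
the saddle value with the optimal values. -/

namespace ASGARD

/-! ### Parameter recursions and their rates. -/

section Parameters

theorem existsUnique_cubic_root {t : ℝ} (ht : t ∈ Set.Ioc (0 : ℝ) 1) :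
    ∃! s : ℝ, s ∈ Set.Ioo (0 : ℝ) 1 ∧ cubic t s = 0 := by
  have h0 : 0 < t ^ 2 := pow_pos ht.1 2
  have hc : ContinuousOn (cubic t) (Set.Icc 0 1) := by unfold cubic; fun_prop
  have hmem : (0 : ℝ) ∈ Set.Ioo (cubic t 0) (cubic t 1) := by
    constructor <;> simp only [cubic] <;> linarith
  obtain ⟨s, hs, hs0⟩ := intermediate_value_Ioo zero_le_one hc hmem
  refine ⟨s, ⟨hs, hs0⟩, ?_⟩
  rintro r ⟨hr, hr0⟩
  -- The difference of the two cubic values, divided by `r - s`, is a positive quadratic form plus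
  -- positive terms.
  have hfac : (r - s) * (r ^ 2 + r * s + s ^ 2 + r + s + t ^ 2) = 0 := by
    unfold cubic at hs0 hr0
    linear_combination hr0 - hs0
  have := hr.1
  have := hs.1
  have hpos : 0 < r ^ 2 + r * s + s ^ 2 + r + s + t ^ 2 := by positivity
  rcases mul_eq_zero.1 hfac with h | h
  · linarith
  · exact absurd h hpos.ne'

variable {τ : ℕ → ℝ}

theorem IsTauSeq.pos (h : IsTauSeq τ) (k : ℕ) : 0 < τ k := by
  cases k with
  | zero => rw [h.zero]; exact one_pos
  | succ k => exact (h.succ_mem k).1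

theorem IsTauSeq.le_one (h : IsTauSeq τ) (k : ℕ) : τ k ≤ 1 := by
  cases k with
  | zero => rw [h.zero]
  | succ k => exact (h.succ_mem k).2.le

theorem IsTauSeq.sq_mul_one_add (h : IsTauSeq τ) (k : ℕ) :
    τ (k + 1) ^ 2 * (1 + τ (k + 1)) = τ k ^ 2 * (1 - τ (k + 1)) := by
  have := h.succ_root k
  unfold cubic at this
  linear_combination this

/-- Source of both rates. If it failed at `k + 1`, the cubic and the bound for `τ k` would give `1 <
s(1 + s)a < 1 - s²` with `a = k + 1`. -/
theorem IsTauSeq.inv_le (h : IsTauSeq τ) (k : ℕ) : 1 ≤ τ k * (k + 1) := by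
  induction k with
  | zero => simp [h.zero]
  | succ k ih =>
    have hroot := h.sq_mul_one_add k
    have hs := h.succ_mem k
    have ht := h.pos k
    push_cast
    set s := τ (k + 1)
    set t := τ k
    by_contra! hlt
    have hk : (0 : ℝ) ≤ k := Nat.cast_nonneg k
    set a : ℝ := (k : ℝ) + 1
    have ha : 0 < a := by positivity
    -- `1 - s > s * a`, hence `s² (1 + s) > t² s a`
    have h1 : s * a < 1 - s := by linarith
    have h2 : t ^ 2 * (s * a) < s ^ 2 * (1 + s) := by
      rw [hroot]; exact mul_lt_mul_of_pos_left h1 (by positivity)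
    have h3 : t ^ 2 * a < s * (1 + s) := by
      have : s * (t ^ 2 * a) < s * (s * (1 + s)) := by linarith [h2]
      exact lt_of_mul_lt_mul_left this hs.1.le
    have h4 : 1 ≤ (t * a) ^ 2 := one_le_pow₀ ih
    have h5 : 1 < s * (1 + s) * a := by nlinarith
    have h6 : s * a * (1 + s) < (1 - s) * (1 + s) :=
      mul_lt_mul_of_pos_right h1 (by linarith [hs.1])
    nlinarith [sq_nonneg s]

variable {β₀ : ℝ}

theorem betaSeq_pos (hβ : 0 < β₀) (h : IsTauSeq τ) (k : ℕ) : 0 < betaSeq β₀ τ k := by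
  induction k with
  | zero => exact hβ
  | succ k ih => exact div_pos ih (by linarith [h.pos (k + 1)])

theorem betaSeq_eq (h : IsTauSeq τ) (k : ℕ) :
    betaSeq β₀ τ k = (1 + τ (k + 1)) * betaSeq β₀ τ (k + 1) := by
  have := h.pos (k + 1)
  simp only [betaSeq]
  field_simp

/-- Induction with `(1 + τ_{k+1})(k + 2) ≥ k + 3`, which is `inv_le`. -/
theorem betaSeq_le (hβ : 0 < β₀) (h : IsTauSeq τ) (k : ℕ) :
    betaSeq β₀ τ k * (k + 2) ≤ 2 * β₀ := by
  induction k with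
  | zero => simp [betaSeq, mul_comm]
  | succ k ih =>
    rw [betaSeq_eq h k] at ih
    have h1 := h.inv_le (k + 1)
    have h2 := betaSeq_pos hβ h (k + 1)
    push_cast at *
    nlinarith

variable {p n : ℕ} {K : Euc p →L[ℝ] Euc n}

theorem LSeq_zero_eq (k : ℕ) : LSeq K 0 β₀ τ k = ‖K‖ ^ 2 / betaSeq β₀ τ k := by
  simp [LSeq]

theorem LSeq_pos (hK : K ≠ 0) (hβ : 0 < β₀) (h : IsTauSeq τ) (k : ℕ) :
    0 < LSeq K 0 β₀ τ k := by
  rw [LSeq_zero_eq]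
  exact div_pos (pow_pos (norm_pos_iff.2 hK) 2) (betaSeq_pos hβ h k)

theorem LSeq_succ (hβ : 0 < β₀) (h : IsTauSeq τ) (k : ℕ) :
    LSeq K 0 β₀ τ (k + 1) = LSeq K 0 β₀ τ k * (1 + τ (k + 1)) := by
  have := h.pos (k + 1)
  have := betaSeq_pos hβ h k
  simp only [LSeq_zero_eq, betaSeq]
  field_simp

/-- This identity is what the cubic encodes: the distance terms of consecutive steps match exactly.
-/
theorem LSeq_mul_tau_sq_succ (hβ : 0 < β₀) (h : IsTauSeq τ) (k : ℕ) :
    LSeq K 0 β₀ τ (k + 1) * τ (k + 1) ^ 2 = (1 - τ (k + 1)) * (LSeq K 0 β₀ τ k * τ k ^ 2) := by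
  rw [LSeq_succ hβ h]
  linear_combination LSeq K 0 β₀ τ k * h.sq_mul_one_add k

theorem LSeq_mul_tau_sq_le (hK : K ≠ 0) (hβ : 0 < β₀) (h : IsTauSeq τ) (k : ℕ) :
    LSeq K 0 β₀ τ k * τ k ^ 2 * (k + 1) ≤ ‖K‖ ^ 2 / β₀ := by
  induction k with
  | zero => simp [LSeq_zero_eq, betaSeq, h.zero]
  | succ k ih =>
    rw [LSeq_mul_tau_sq_succ hβ h]
    have h1 := h.inv_le (k + 1)
    have h2 : 0 ≤ LSeq K 0 β₀ τ k * τ k ^ 2 :=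
      mul_nonneg (LSeq_pos hK hβ h k).le (sq_nonneg _)
    push_cast at *
    nlinarith

/-- The cubic simplifies the denominator of `η_{k+1}` to `τ_k² / τ_{k+1}`, leaving the momentum for
which `x̂` is the combination of `x` and `x̃` in `xhat_eq`. -/
theorem etaSucc_eq (hK : K ≠ 0) (hβ : 0 < β₀) (h : IsTauSeq τ) (k : ℕ) :
    etaSucc K 0 0 β₀ τ k = (1 - τ k) * τ (k + 1) / τ k := by
  have hL := LSeq_pos hK hβ h k
  have hm : mSucc K 0 0 β₀ τ k = 1 + τ (k + 1) := by
    simp only [mSucc, add_zero, LSeq_succ hβ h]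
    field_simp
  have h0 := h.pos k
  have h1 := h.pos (k + 1)
  have hden : (τ k ^ 2 + (1 + τ (k + 1)) * τ (k + 1)) * τ (k + 1) = τ k ^ 2 := by
    linear_combination h.sq_mul_one_add k
  rw [etaSucc, hm, div_eq_div_iff (by positivity) h0.ne']
  linear_combination -(1 - τ k) * hden

end Parameters

/-! ### Proximal optimality and the one-step inequality. -/

section Descent

variable {E F : Type*} [NormedAddCommGroup E] [InnerProductSpace ℝ E]
  [NormedAddCommGroup F] [InnerProductSpace ℝ F]

/-- The optimality condition of a proximal step, in terms of the subgradient `(u - z) / γ`. -/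
theorem subgradient_of_prox {C : Set E} {φ : E → ℝ} (hφ : ConvexOn ℝ C φ) {γ : ℝ} (hγ : 0 < γ)
    {u z : E} (hz : z ∈ C)
    (hmin : ∀ w ∈ C, φ z + 1 / (2 * γ) * ‖z - u‖ ^ 2 ≤ φ w + 1 / (2 * γ) * ‖w - u‖ ^ 2)
    {w : E} (hw : w ∈ C) : φ z + inner ℝ ((1 / γ) • (u - z)) (w - z) ≤ φ w := by
  by_contra! hlt
  set Q : ℝ := 1 / (2 * γ) * ‖w - z‖ ^ 2
  have hQ : 0 ≤ Q := by positivity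
  set d : ℝ := φ w - φ z - inner ℝ ((1 / γ) • (u - z)) (w - z) with hd
  have hd0 : d < 0 := by linarith
  -- Compare `z` with the points of the segment towards `w`, then divide by `t`.
  have key : ∀ t : ℝ, 0 < t → t ≤ 1 → 0 ≤ d + t * Q := by
    intro t ht ht1
    have hconv := hφ.2 hz hw (sub_nonneg.2 ht1) ht.le (by ring)
    have hm := hmin _ (hφ.1 hz hw (sub_nonneg.2 ht1) ht.le (by ring))
    have heq : (1 - t) • z + t • w - u = (z - u) + t • (w - z) := by module
    have hn : ‖(1 - t) • z + t • w - u‖ ^ 2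
        = ‖z - u‖ ^ 2 + 2 * t * inner ℝ (z - u) (w - z) + t ^ 2 * ‖w - z‖ ^ 2 := by
      rw [heq, norm_add_sq_real, inner_smul_right, norm_smul, mul_pow, Real.norm_eq_abs, sq_abs]
      ring
    have hi : inner ℝ ((1 / γ) • (u - z)) (w - z) = -(1 / γ) * inner ℝ (z - u) (w - z) := by
      rw [real_inner_smul_left, ← neg_sub z u, inner_neg_left]; ring
    rw [hn] at hm
    simp only [smul_eq_mul] at hconv
    have : 0 ≤ t * (d + t * Q) := by
      have e : t * (d + t * Q) = t * (φ w - φ z) + 1 / (2 * γ) *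
          (2 * t * inner ℝ (z - u) (w - z) + t ^ 2 * ‖w - z‖ ^ 2) := by
        rw [hd, hi]; simp only [Q]; field_simp; ring
      rw [e]; linarith
    exact nonneg_of_mul_nonneg_right this ht
  have hQd : 0 < Q - d := by linarith
  -- An explicit `t` in `(0, 1]`, valid even if `Q = 0`, that makes `d + t * Q` negative; no limit
  -- `t → 0` is needed.
  have h1 := key (-d / (Q - d)) (div_pos (by linarith) hQd) ((div_le_one hQd).2 (by linarith))
  have h2 : d + -d / (Q - d) * Q = -(d ^ 2 / (Q - d)) := by field_simp; ring
  have h3 : 0 < d ^ 2 / (Q - d) := div_pos (sq_pos_iff.2 hd0.ne) hQd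
  linarith

/-- One iteration of the accelerated smoothed primal-dual scheme. -/
theorem accelerated_step {C : Set E} {φ : E → ℝ} (hφ : ConvexOn ℝ C φ)
    {D : Set F} {ψ : F → ℝ} (hψ : ConvexOn ℝ D ψ) {K : E →L[ℝ] F} {β L τ : ℝ} (hβ : 0 < β)
    (hL : L = ‖K‖ ^ 2 / β) (hτ : 0 < τ) (hτ1 : τ ≤ 1)
    {x xk xt xn xtn : E} (hx : x ∈ C) (hxk : xk ∈ C) (hxn : xn = (1 - τ) • xk + τ • xtn)
    {y yn yt ydot : F} (hy : y ∈ D) (hyn : yn ∈ D) (hyt : yt ∈ D)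
    (hψyn : ∀ w ∈ D,
      ψ yn + inner ℝ (β • (ydot - yn) + K ((1 - τ) • xk + τ • xt)) (w - yn) ≤ ψ w)
    (hφxn : ∀ w ∈ C, φ xn + (L * inner ℝ ((1 - τ) • xk + τ • xt - xn) (w - xn)
      - inner ℝ yn (K (w - xn))) ≤ φ w) :
    φ xn + inner ℝ (K xn) y - ψ y - β / 2 * ‖y - ydot‖ ^ 2
      - (φ x + inner ℝ (K x) ((1 - τ) • yt + τ • yn) - ψ ((1 - τ) • yt + τ • yn))
      + L * τ ^ 2 / 2 * ‖x - xtn‖ ^ 2 ≤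
    (1 - τ) * (φ xk + inner ℝ (K xk) yn - ψ yn - (1 + τ) * β / 2 * ‖yn - ydot‖ ^ 2
      - (φ x + inner ℝ (K x) yt - ψ yt)) + L * τ ^ 2 / 2 * ‖x - xt‖ ^ 2 := by
  -- Testing at `(1 - τ) xk + τ x` rather than at `x` produces the factor `τ²` on the distances.
  have h1 := hφxn _ (hφ.1 hxk hx (sub_nonneg.2 hτ1) hτ.le (by ring))
  have h1' := hφ.2 hxk hx (sub_nonneg.2 hτ1) hτ.le (by ring)
  have h2 := hψyn y hy
  have h3 := hψ.2 hyt hyn (sub_nonneg.2 hτ1) hτ.le (by ring)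
  have e1 : (1 - τ) • xk + τ • x - xn = τ • (x - xtn) := by rw [hxn]; module
  have e2 : (1 - τ) • xk + τ • xt - xn = τ • (xt - xtn) := by rw [hxn]; module
  have e3 : inner ℝ (xt - xtn) (x - xtn)
      = (‖xt - xtn‖ ^ 2 + ‖x - xtn‖ ^ 2 - ‖x - xt‖ ^ 2) / 2 := by
    have : ‖x - xt‖ ^ 2 = ‖(xt - xtn) - (x - xtn)‖ ^ 2 := by
      rw [← norm_neg]; congr 2; abel
    rw [this, norm_sub_sq_real (xt - xtn) (x - xtn)]; ring
  have e4 : inner ℝ (ydot - yn) (y - yn)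
      = (‖yn - ydot‖ ^ 2 + ‖y - yn‖ ^ 2 - ‖y - ydot‖ ^ 2) / 2 := by
    have : ‖y - ydot‖ ^ 2 = ‖(ydot - yn) - (y - yn)‖ ^ 2 := by
      rw [← norm_neg]; congr 2; abel
    rw [this, norm_sub_sq_real (ydot - yn) (y - yn), norm_sub_rev yn ydot]; ring
  -- The coupling error `K (xn - x̂)` is absorbed by the two quadratic terms; `L = ‖K‖² / β` makes
  -- the slack a perfect square.
  have young : τ * inner ℝ (K (xtn - xt)) (y - yn)
      ≤ L / 2 * τ ^ 2 * ‖xt - xtn‖ ^ 2 + β / 2 * ‖y - yn‖ ^ 2 := by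
    have a1 : inner ℝ (K (xtn - xt)) (y - yn) ≤ ‖K‖ * ‖xt - xtn‖ * ‖y - yn‖ := by
      refine (real_inner_le_norm _ _).trans ?_
      rw [norm_sub_rev xt xtn]
      gcongr
      exact K.le_opNorm _
    have a2 : τ * inner ℝ (K (xtn - xt)) (y - yn) ≤ τ * (‖K‖ * ‖xt - xtn‖ * ‖y - yn‖) := by
      gcongr
    refine a2.trans ?_
    have a3 : L / 2 * τ ^ 2 * ‖xt - xtn‖ ^ 2 + β / 2 * ‖y - yn‖ ^ 2
        - τ * (‖K‖ * ‖xt - xtn‖ * ‖y - yn‖)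
        = (τ * ‖K‖ * ‖xt - xtn‖ - β * ‖y - yn‖) ^ 2 / (2 * β) := by
      rw [hL]; field_simp; ring
    have : 0 ≤ (τ * ‖K‖ * ‖xt - xtn‖ - β * ‖y - yn‖) ^ 2 / (2 * β) := by positivity
    linarith
  -- Slack from `(1 - τ)(1 + τ) ≤ 1`: it pays for decreasing `β` by the factor `1 + τ`.
  have hN : 0 ≤ τ ^ 2 * β * ‖yn - ydot‖ ^ 2 := by positivity
  rw [e1, e2, real_inner_smul_left, real_inner_smul_right, e3, map_smul, real_inner_smul_right]
    at h1
  rw [inner_add_left, real_inner_smul_left, e4] at h2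
  simp only [hxn, map_add, map_sub, map_smul, inner_add_left, inner_add_right, inner_sub_left,
    inner_sub_right, real_inner_smul_left, real_inner_smul_right, smul_eq_mul] at *
  have c1 := real_inner_comm yn (K x)
  have c2 := real_inner_comm yn (K xtn)
  rw [← c1, ← c2] at h1
  linarith

end Descent

/-! ### Conjugates, proximal points and restricted suprema. -/

section Conjugate

open Filter Topology

variable {d : ℕ} {h : Euc d → EReal}

theorem ProperClosedConvex.coe_toReal (hh : ProperClosedConvex h) {u : Euc d} (hu : u ∈ dom h) :
    (((h u).toReal : ℝ) : EReal) = h u :=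
  EReal.coe_toReal (ne_of_lt hu) (hh.ne_bot u)

theorem eq_top_of_notMem_dom {u : Euc d} (hu : u ∉ dom h) : h u = ⊤ :=
  not_lt_top_iff.1 hu

theorem ProperClosedConvex.convexOn (hh : ProperClosedConvex h) :
    ConvexOn ℝ (dom h) fun u => (h u).toReal := by
  have key : ∀ u ∈ dom h, ∀ v ∈ dom h, ∀ a b : ℝ, 0 ≤ a → 0 ≤ b → a + b = 1 →
      h (a • u + b • v) ≤ ((a * (h u).toReal + b * (h v).toReal : ℝ) : EReal) := by
    intro u hu v hv a b ha hb hab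
    exact hh.convex_epi (x := (u, (h u).toReal)) (hh.coe_toReal hu).ge
      (y := (v, (h v).toReal)) (hh.coe_toReal hv).ge ha hb hab
  have hdom : Convex ℝ (dom h) := fun u hu v hv a b ha hb hab =>
    (key u hu v hv a b ha hb hab).trans_lt (EReal.coe_lt_top _)
  refine ⟨hdom, fun u hu v hv a b ha hb hab => ?_⟩
  have := key u hu v hv a b ha hb hab
  rw [← hh.coe_toReal (hdom hu hv ha hb hab)] at this
  exact EReal.coe_le_coe_iff.1 this

theorem ProperClosedConvex.le_of_tendsto (hh : ProperClosedConvex h) {z : ℕ → Euc d} {u : Euc d}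
    (hz : Tendsto z atTop (𝓝 u)) {C : ℝ} (hC : ∀ m, h (z m) ≤ (C : EReal)) :
    h u ≤ (C : EReal) :=
  hh.isClosed_epi.mem_of_tendsto (hz.prodMk_nhds (tendsto_const_nhds (x := C)))
    (Eventually.of_forall hC)

theorem ProperClosedConvex.conj_le_coe_iff (hh : ProperClosedConvex h) {v : Euc d} {r : ℝ} :
    conj h v ≤ (r : EReal) ↔ ∀ u ∈ dom h, inner ℝ v u - (h u).toReal ≤ r := by
  rw [conj, iSup_le_iff]
  refine forall_congr' fun u => ?_
  by_cases hu : u ∈ dom h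
  · rw [← hh.coe_toReal hu]
    simp only [hu, forall_true_left, EReal.toReal_coe]
    norm_cast
  · simp [hu, eq_top_of_notMem_dom hu]

theorem ProperClosedConvex.conj_ne_bot (hh : ProperClosedConvex h) (v : Euc d) :
    conj h v ≠ ⊥ := by
  obtain ⟨u, hu⟩ := hh.dom_nonempty
  intro hb
  have : conj h v ≤ ((inner ℝ v u - (h u).toReal - 1 : ℝ) : EReal) := hb ▸ bot_le
  linarith [hh.conj_le_coe_iff.1 this u hu]

theorem ProperClosedConvex.coe_toReal_conj (hh : ProperClosedConvex h) {v : Euc d}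
    (hv : v ∈ dom (conj h)) : (((conj h v).toReal : ℝ) : EReal) = conj h v :=
  EReal.coe_toReal (ne_of_lt hv) (hh.conj_ne_bot v)

theorem ProperClosedConvex.fenchel_young (hh : ProperClosedConvex h) {u v : Euc d}
    (hu : u ∈ dom h) (hv : v ∈ dom (conj h)) :
    inner ℝ v u - (h u).toReal ≤ (conj h v).toReal :=
  hh.conj_le_coe_iff.1 (hh.coe_toReal_conj hv).ge u hu

/-- The epigraph of a conjugate is an intersection of closed half-spaces. -/
theorem ProperClosedConvex.conj (hh : ProperClosedConvex h) (hne : (dom (conj h)).Nonempty) :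
    ProperClosedConvex (conj h) := by
  have hepi : {q : Euc d × ℝ | ASGARD.conj h q.1 ≤ (q.2 : EReal)} =
      ⋂ u ∈ dom h, {q : Euc d × ℝ | inner ℝ q.1 u - (h u).toReal ≤ q.2} := by
    ext q
    simp only [Set.mem_ofPred_eq, Set.mem_iInter]
    exact hh.conj_le_coe_iff
  refine ⟨hh.conj_ne_bot, hne, ?_, ?_⟩
  · rw [hepi]
    exact isClosed_biInter fun u _ => isClosed_le (by fun_prop) (by fun_prop)
  · rw [hepi]
    refine convex_iInter₂ fun u _ q hq q' hq' a b ha hb hab => ?_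
    simp only [Set.mem_ofPred_eq, Prod.fst_add, Prod.smul_fst, Prod.snd_add, Prod.smul_snd,
      inner_add_left, real_inner_smul_left, smul_eq_mul] at *
    have hb' : b = 1 - a := by linarith
    subst hb'
    nlinarith

theorem IsProx.toReal_le (hh : ProperClosedConvex h) {γ : ℝ} {u z : Euc d} (hz : IsProx γ h u z)
    {w : Euc d} (hw : w ∈ dom h) :
    (h z).toReal + 1 / (2 * γ) * ‖z - u‖ ^ 2 ≤ (h w).toReal + 1 / (2 * γ) * ‖w - u‖ ^ 2 := by
  have := hz.2 w
  rw [← hh.coe_toReal hz.1, ← hh.coe_toReal hw] at this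
  exact_mod_cast this

theorem IsProx.subgradient (hh : ProperClosedConvex h) {γ : ℝ} (hγ : 0 < γ) {u z : Euc d}
    (hz : IsProx γ h u z) {w : Euc d} (hw : w ∈ dom h) :
    (h z).toReal + inner ℝ ((1 / γ) • (u - z)) (w - z) ≤ (h w).toReal :=
  subgradient_of_prox hh.convexOn hγ hz.1 (fun _ hw => hz.toReal_le hh hw) hw

theorem ProperClosedConvex.mem_subdiff (hh : ProperClosedConvex h) {u v : Euc d} (hu : u ∈ dom h)
    (hv : ∀ w ∈ dom h, (h u).toReal + inner ℝ v (w - u) ≤ (h w).toReal) : v ∈ subdiff h u := by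
  refine ⟨hu, fun w => ?_⟩
  by_cases hw : w ∈ dom h
  · rw [← hh.coe_toReal hu, ← hh.coe_toReal hw]
    exact_mod_cast hv w hw
  · rw [eq_top_of_notMem_dom hw]
    exact le_top

/-- The equality case of Fenchel–Young. -/
theorem ProperClosedConvex.conj_eq_of_subgradient (hh : ProperClosedConvex h) {u v : Euc d}
    (hu : u ∈ dom h) (hv : ∀ w ∈ dom h, (h u).toReal + inner ℝ v (w - u) ≤ (h w).toReal) :
    v ∈ dom (ASGARD.conj h) ∧ (ASGARD.conj h v).toReal = inner ℝ v u - (h u).toReal := by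
  have hle : ASGARD.conj h v ≤ ((inner ℝ v u - (h u).toReal : ℝ) : EReal) := by
    refine hh.conj_le_coe_iff.2 fun w hw => ?_
    have := hv w hw
    rw [inner_sub_right] at this
    linarith
  have hdom : v ∈ dom (ASGARD.conj h) := hle.trans_lt (EReal.coe_lt_top _)
  refine ⟨hdom, le_antisymm ?_ (hh.fenchel_young hu hdom)⟩
  rw [← hh.coe_toReal_conj hdom] at hle
  exact EReal.coe_le_coe_iff.1 hle

/-- Proximal points exist for functions that have an affine minorant. -/
theorem ProperClosedConvex.exists_isProx (hh : ProperClosedConvex h)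
    (hne : (dom (ASGARD.conj h)).Nonempty) {γ : ℝ} (hγ : 0 < γ) (u : Euc d) :
    ∃ z, IsProx γ h u z := by
  obtain ⟨v, hv⟩ := hne
  obtain ⟨w₀, hw₀⟩ := hh.dom_nonempty
  set c := (ASGARD.conj h v).toReal
  set a : ℝ := 1 / (2 * γ)
  have ha : 0 < a := by positivity
  set ψ : Euc d × ℝ → ℝ := fun q => q.2 + a * ‖q.1 - u‖ ^ 2
  have hψ : Continuous ψ := by fun_prop
  set s₀ := ψ (w₀, (h w₀).toReal)
  -- Minimizing over the epigraph makes the objective continuous, so closedness of the epigraph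
  -- replaces lower semicontinuity.
  set S : Set (Euc d × ℝ) := {q | h q.1 ≤ (q.2 : EReal)} ∩ {q | ψ q ≤ s₀}
  set T : ℝ := |s₀ + c - inner ℝ v u|
  -- Beyond this radius the quadratic outgrows the affine minorant given by `v`; the `+ 1` ensures
  -- `T ≤ T * ‖w - u‖` there.
  set R : ℝ := (‖v‖ + T) / a + 1
  have hSc : IsCompact S := by
    refine ((isCompact_closedBall u R).prod
      (isCompact_Icc (a := inner ℝ v u - ‖v‖ * R - c) (b := s₀))).of_isClosed_subset
      (hh.isClosed_epi.inter (isClosed_le hψ continuous_const)) ?_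
    rintro ⟨w, r⟩ ⟨hwr, hs⟩
    simp only [Set.mem_ofPred_eq, ψ] at hwr hs
    have hw : w ∈ dom h := hwr.trans_lt (EReal.coe_lt_top _)
    have h1 := hh.fenchel_young hw hv
    rw [← hh.coe_toReal hw, EReal.coe_le_coe_iff] at hwr
    have h2 : -(‖v‖ * ‖w - u‖) ≤ inner ℝ v (w - u) :=
      neg_le_of_abs_le (abs_real_inner_le_norm _ _)
    rw [inner_sub_right] at h2
    have hT : s₀ + c - inner ℝ v u ≤ T := le_abs_self _
    have hT0 : 0 ≤ T := abs_nonneg _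
    have hd : ‖w - u‖ ≤ R := by
      by_contra! hlt
      have h1R : 1 ≤ R := le_add_of_nonneg_left (by positivity)
      have h3 : ‖v‖ + T < a * ‖w - u‖ := by
        have : (‖v‖ + T) / a < ‖w - u‖ := by linarith
        rwa [div_lt_iff₀' ha] at this
      have h4 : (‖v‖ + T) * ‖w - u‖ < a * ‖w - u‖ * ‖w - u‖ :=
        mul_lt_mul_of_pos_right h3 (by linarith)
      have h5 : T * 1 ≤ T * ‖w - u‖ := mul_le_mul_of_nonneg_left (by linarith) hT0
      nlinarith
    have h6 : ‖v‖ * ‖w - u‖ ≤ ‖v‖ * R := by gcongr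
    have h7 : 0 ≤ a * ‖w - u‖ ^ 2 := by positivity
    refine ⟨by simpa [dist_eq_norm] using hd, ?_, ?_⟩
    · change inner ℝ v u - ‖v‖ * R - c ≤ r
      linarith
    · change r ≤ s₀
      linarith
  have hmem₀ : (w₀, (h w₀).toReal) ∈ S := ⟨(hh.coe_toReal hw₀).ge, le_refl s₀⟩
  obtain ⟨⟨z, r⟩, hzS, hmin⟩ := hSc.exists_isMinOn ⟨_, hmem₀⟩ hψ.continuousOn
  have hzr : h z ≤ (r : EReal) := hzS.1
  have hz : z ∈ dom h := hzr.trans_lt (EReal.coe_lt_top _)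
  refine ⟨z, hz, fun w => ?_⟩
  by_cases hw : w ∈ dom h
  · rw [← hh.coe_toReal hz, EReal.coe_le_coe_iff] at hzr
    have hle : ψ (z, r) ≤ ψ (w, (h w).toReal) := by
      by_cases hws : ψ (w, (h w).toReal) ≤ s₀
      · exact hmin ⟨(hh.coe_toReal hw).ge, hws⟩
      · exact (hmin hmem₀).trans (not_le.1 hws).le
    rw [← hh.coe_toReal hz, ← hh.coe_toReal hw]
    have : (h z).toReal + a * ‖z - u‖ ^ 2 ≤ (h w).toReal + a * ‖w - u‖ ^ 2 := by
      simp only [ψ] at hle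
      linarith
    exact_mod_cast this
  · rw [eq_top_of_notMem_dom hw, EReal.top_add_coe]
    exact le_top

/-- If the subgradients of `h` are bounded by `M`, then `h` is the supremum of the affine functions
that come from the points of norm at most `M` in the domain of the conjugate. -/
theorem ProperClosedConvex.le_of_forall_conj_le (hh : ProperClosedConvex h)
    (hne : (dom (ASGARD.conj h)).Nonempty) {M : ℝ}
    (hM : ∀ z ∈ dom h, ∀ v ∈ subdiff h z, ‖v‖ ≤ M) {u : Euc d} {C : ℝ}
    (hC : ∀ v ∈ dom (ASGARD.conj h), ‖v‖ ≤ M → inner ℝ u v - (ASGARD.conj h v).toReal ≤ C) :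
    h u ≤ (C : EReal) := by
  have hpos : ∀ m : ℕ, (0 : ℝ) < 1 / ((m : ℝ) + 1) := fun m => by positivity
  -- The subgradients `(m + 1)(u - z m)` have norm at most `M`, so `z m → u` even before `u` is
  -- known to lie in the domain.
  choose z hz using fun m : ℕ => hh.exists_isProx hne (hpos m) u
  have hsub := fun m => fun w hw => (hz m).subgradient hh (hpos m) (w := w) hw
  have hnorm : ∀ m : ℕ, ‖z m - u‖ ≤ M * (1 / ((m : ℝ) + 1)) := by
    intro m
    have := hM _ (hz m).1 _ (hh.mem_subdiff (hz m).1 (hsub m))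
    rw [norm_smul, Real.norm_of_nonneg (by positivity), norm_sub_rev, one_div_one_div] at this
    rw [mul_one_div, le_div_iff₀ (by positivity)]
    linarith
  have hle : ∀ m, h (z m) ≤ (C : EReal) := by
    intro m
    obtain ⟨hd, heq⟩ := hh.conj_eq_of_subgradient (hz m).1 (hsub m)
    have h1 := hC _ hd (hM _ (hz m).1 _ (hh.mem_subdiff (hz m).1 (hsub m)))
    have h2 : 0 ≤ inner ℝ ((1 / (1 / ((m : ℝ) + 1))) • (u - z m)) (u - z m) := by
      rw [real_inner_smul_left, real_inner_self_eq_norm_sq]; positivity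
    rw [inner_sub_right] at h2
    rw [heq, real_inner_comm] at h1
    rw [← hh.coe_toReal (hz m).1, EReal.coe_le_coe_iff]
    linarith
  have hlim : Tendsto z atTop (𝓝 u) := by
    rw [tendsto_iff_norm_sub_tendsto_zero]
    refine squeeze_zero (fun _ => norm_nonneg _) hnorm ?_
    simpa using tendsto_one_div_add_atTop_nhds_zero_nat.const_mul M
  exact hh.le_of_tendsto hlim hle

/-- If the subgradients of the conjugate of `h` are bounded by `M`, then the supremum that defines
it can be restricted to points of norm at most `M`. -/
theorem ProperClosedConvex.conj_le_of_forall_le (hh : ProperClosedConvex h)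
    (hne : (dom (ASGARD.conj h)).Nonempty) {M : ℝ}
    (hM : ∀ v ∈ dom (ASGARD.conj h), ∀ z ∈ subdiff (ASGARD.conj h) v, ‖z‖ ≤ M)
    {u : Euc d} {C : ℝ} (hC : ∀ z ∈ dom h, ‖z‖ ≤ M → inner ℝ u z - (h z).toReal ≤ C) :
    ASGARD.conj h u ≤ (C : EReal) := by
  have hpos : ∀ m : ℕ, (0 : ℝ) < (m : ℝ) + 1 := fun m => by positivity
  -- Moreau decomposition: `v m = u - z m / (m + 1)` is the proximal point of `h*` at `u` with
  -- parameter `1 / (m + 1)`. Working with the prox of `h` avoids biconjugation.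
  choose z hz using fun m : ℕ => hh.exists_isProx hne (hpos m) (((m : ℝ) + 1) • u)
  obtain ⟨v, hv⟩ : ∃ v : ℕ → Euc d, ∀ m, v m = u - (1 / ((m : ℝ) + 1)) • z m := ⟨_, fun _ => rfl⟩
  have hconj : ∀ m, v m ∈ dom (ASGARD.conj h) ∧
      (ASGARD.conj h (v m)).toReal = inner ℝ (v m) (z m) - (h (z m)).toReal := by
    intro m
    have e : v m = (1 / ((m : ℝ) + 1)) • (((m : ℝ) + 1) • u - z m) := by
      rw [hv, smul_sub, smul_smul, one_div_mul_cancel (hpos m).ne', one_smul]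
    rw [e]
    exact hh.conj_eq_of_subgradient (hz m).1 fun w hw => (hz m).subgradient hh (hpos m) hw
  have hbound : ∀ m, ‖z m‖ ≤ M := by
    intro m
    -- Equality in Fenchel–Young makes `z m` a subgradient of `h*` at `v m`.
    refine hM _ (hconj m).1 _ ((hh.conj hne).mem_subdiff (hconj m).1 fun w hw => ?_)
    have := hh.fenchel_young (hz m).1 hw
    rw [(hconj m).2, inner_sub_right, real_inner_comm w, real_inner_comm (v m)]
    linarith
  have hle : ∀ m, ASGARD.conj h (v m) ≤ (C : EReal) := by
    intro m
    have h1 := hC _ (hz m).1 (hbound m)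
    have h2 : 0 ≤ inner ℝ ((1 / ((m : ℝ) + 1)) • z m) (z m) := by
      rw [real_inner_smul_left, real_inner_self_eq_norm_sq]
      have := hpos m
      positivity
    rw [← hh.coe_toReal_conj (hconj m).1, EReal.coe_le_coe_iff, (hconj m).2, hv m, inner_sub_left]
    linarith
  have hlim : Tendsto v atTop (𝓝 u) := by
    rw [tendsto_iff_norm_sub_tendsto_zero]
    refine squeeze_zero (g := fun m : ℕ => M * (1 / ((m : ℝ) + 1))) (fun _ => norm_nonneg _) ?_ ?_
    · intro m
      have := hpos m
      rw [hv m, sub_sub_cancel_left, norm_neg, norm_smul, Real.norm_of_nonneg (by positivity),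
        mul_comm]
      exact mul_le_mul_of_nonneg_right (hbound m) (by positivity)
    · simpa using tendsto_one_div_add_atTop_nhds_zero_nat.const_mul M
  exact (hh.conj hne).le_of_tendsto hlim hle

end Conjugate

/-! ### Saddle points and weak duality. -/

section Saddle

variable {p n : ℕ} {f : Euc p → EReal} {g : Euc n → EReal} {K : Euc p →L[ℝ] Euc n}

/-- The real value of the Lagrangian on `dom f × dom g*`. -/
noncomputable def realLagrangian (f : Euc p → EReal) (g : Euc n → EReal) (K : Euc p →L[ℝ] Euc n)
    (x : Euc p) (y : Euc n) : ℝ :=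
  (f x).toReal + inner ℝ (K x) y - (conj g y).toReal

theorem lagrangian_eq_coe (hf : ProperClosedConvex f) (hg : ProperClosedConvex g) {x : Euc p}
    {y : Euc n} (hx : x ∈ dom f) (hy : y ∈ dom (conj g)) :
    lagrangian f g K x y = (realLagrangian f g K x y : EReal) := by
  rw [lagrangian, ← hf.coe_toReal hx, ← hg.coe_toReal_conj hy]
  norm_cast

theorem IsSaddlePoint.real_le_right (hf : ProperClosedConvex f) (hg : ProperClosedConvex g)
    {xs : Euc p} {ys : Euc n} (hs : IsSaddlePoint f g K xs ys) {y : Euc n}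
    (hy : y ∈ dom (conj g)) : realLagrangian f g K xs y ≤ realLagrangian f g K xs ys := by
  have := hs.le_right y hy
  rwa [lagrangian_eq_coe hf hg hs.mem_dom_left hy,
    lagrangian_eq_coe hf hg hs.mem_dom_left hs.mem_dom_right, EReal.coe_le_coe_iff] at this

theorem IsSaddlePoint.real_le_left (hf : ProperClosedConvex f) (hg : ProperClosedConvex g)
    {xs : Euc p} {ys : Euc n} (hs : IsSaddlePoint f g K xs ys) {x : Euc p}
    (hx : x ∈ dom f) : realLagrangian f g K xs ys ≤ realLagrangian f g K x ys := by
  have := hs.le_left x hx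
  rwa [lagrangian_eq_coe hf hg hx hs.mem_dom_right,
    lagrangian_eq_coe hf hg hs.mem_dom_left hs.mem_dom_right, EReal.coe_le_coe_iff] at this

theorem real_inner_neg_adjoint (x : Euc p) (y : Euc n) :
    inner ℝ (-(K.adjoint y)) x = -inner ℝ (K x) y := by
  rw [inner_neg_left, ContinuousLinearMap.adjoint_inner_left, real_inner_comm]

/-- `ℒ(·, y⋆)` is bounded below by the saddle value. This supplies the affine minorant of `f` needed
in (c). -/
theorem IsSaddlePoint.mem_dom_conj_left (hf : ProperClosedConvex f) (hg : ProperClosedConvex g)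
    {xs : Euc p} {ys : Euc n} (hs : IsSaddlePoint f g K xs ys) :
    -(K.adjoint ys) ∈ dom (conj f) := by
  refine lt_of_le_of_lt (hf.conj_le_coe_iff (r := -realLagrangian f g K xs ys -
    (conj g ys).toReal).2 fun x hx => ?_) (EReal.coe_lt_top _)
  have := hs.real_le_left hf hg hx
  rw [real_inner_neg_adjoint]
  unfold realLagrangian at *
  linarith

/-- Fenchel–Young gives `F(x) ≥ ℒ(x, y⋆)`. Only this direction is needed, so strong duality is never
invoked. -/
theorem IsSaddlePoint.le_primalOpt (hf : ProperClosedConvex f) (hg : ProperClosedConvex g)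
    {xs : Euc p} {ys : Euc n} (hs : IsSaddlePoint f g K xs ys) :
    (realLagrangian f g K xs ys : EReal) ≤ primalOpt f g K := by
  refine le_iInf fun x => ?_
  rw [primal]
  by_cases hx : x ∈ dom f
  · by_cases hKx : K x ∈ dom g
    · have h1 := hs.real_le_left hf hg hx
      have h2 := hg.fenchel_young hKx hs.mem_dom_right
      rw [real_inner_comm] at h2
      rw [← hf.coe_toReal hx, ← hg.coe_toReal hKx, ← EReal.coe_add, EReal.coe_le_coe_iff]
      unfold realLagrangian at *
      linarith
    · rw [eq_top_of_notMem_dom hKx, EReal.add_top_of_ne_bot (hf.ne_bot x)]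
      exact le_top
  · rw [eq_top_of_notMem_dom hx, EReal.top_add_of_ne_bot (hg.ne_bot _)]
    exact le_top

theorem IsSaddlePoint.le_dualOpt (hf : ProperClosedConvex f) (hg : ProperClosedConvex g)
    {xs : Euc p} {ys : Euc n} (hs : IsSaddlePoint f g K xs ys) :
    ((-realLagrangian f g K xs ys : ℝ) : EReal) ≤ dualOpt f g K := by
  refine le_iInf fun y => ?_
  rw [dual]
  by_cases hy : y ∈ dom (conj g)
  · by_cases hKy : -(K.adjoint y) ∈ dom (conj f)
    · have h1 := hs.real_le_right hf hg hy
      have h2 := hf.fenchel_young hs.mem_dom_left hKy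
      rw [real_inner_neg_adjoint] at h2
      rw [← hf.coe_toReal_conj hKy, ← hg.coe_toReal_conj hy, ← EReal.coe_add,
        EReal.coe_le_coe_iff]
      unfold realLagrangian at *
      linarith
    · rw [eq_top_of_notMem_dom hKy, EReal.top_add_of_ne_bot (hg.conj_ne_bot _)]
      exact le_top
  · rw [eq_top_of_notMem_dom hy, EReal.add_top_of_ne_bot (hf.conj_ne_bot _)]
    exact le_top

end Saddle

/-! ### The potential along the iterates and the three bounds. -/

section Convergence

variable {p n : ℕ} {f : Euc p → EReal} {g : Euc n → EReal} {K : Euc p →L[ℝ] Euc n}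
  {β₀ : ℝ} {τ : ℕ → ℝ} {ydot : Euc n} {x xhat : ℕ → Euc p} {y ytil : ℕ → Euc n}

theorem IsASGARDPlus.x_mem (h : IsASGARDPlus f g K 0 0 β₀ τ ydot x xhat y ytil) (k : ℕ) :
    x k ∈ dom f := by
  cases k with
  | zero => exact h.x_zero_mem
  | succ k => exact (h.x_succ k).1

theorem IsASGARDPlus.ytil_mem (hg : ProperClosedConvex g) (hτ : IsTauSeq τ)
    (h : IsASGARDPlus f g K 0 0 β₀ τ ydot x xhat y ytil) (k : ℕ) : ytil k ∈ dom (conj g) := by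
  induction k with
  | zero => exact h.ytil_zero_mem
  | succ k ih =>
    rw [h.ytil_succ]
    exact (hg.conj ⟨_, ih⟩).convexOn.1 ih (h.y_succ k).1 (sub_nonneg.2 (hτ.le_one k))
      (hτ.pos k).le (by ring)

/-- The auxiliary points `x̃^k` with `x̂^k = (1 - τ_k) x^k + τ_k x̃^k`. -/
noncomputable def xtil (τ : ℕ → ℝ) (x : ℕ → Euc p) : ℕ → Euc p
  | 0 => x 0
  | k + 1 => x k + (1 / τ k) • (x (k + 1) - x k)

theorem x_succ_eq_xtil (hτ : IsTauSeq τ) (x : ℕ → Euc p) (k : ℕ) :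
    x (k + 1) = (1 - τ k) • x k + τ k • xtil τ x (k + 1) := by
  rw [xtil, smul_add, smul_smul, mul_one_div_cancel (hτ.pos k).ne']
  module

theorem IsASGARDPlus.xhat_eq (hK : K ≠ 0) (hβ : 0 < β₀) (hτ : IsTauSeq τ)
    (h : IsASGARDPlus f g K 0 0 β₀ τ ydot x xhat y ytil) (k : ℕ) :
    xhat k = (1 - τ k) • x k + τ k • xtil τ x k := by
  cases k with
  | zero => rw [h.xhat_zero, hτ.zero, xtil]; module
  | succ k =>
    have h0 := (hτ.pos k).ne'
    have e : (1 - τ k) * τ (k + 1) / τ k = τ (k + 1) * (1 / τ k) - τ (k + 1) := by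
      field_simp
    rw [h.xhat_succ, etaSucc_eq hK hβ hτ, xtil, e]
    module

/-- The quantifier over `v` stays inside the induction, because the previous bound is used at the
next dual iterate. -/
theorem IsASGARDPlus.potential_le (hf : ProperClosedConvex f) (hg : ProperClosedConvex g)
    (hK : K ≠ 0) (hβ : 0 < β₀) (hτ : IsTauSeq τ)
    (h : IsASGARDPlus f g K 0 0 β₀ τ ydot x xhat y ytil) {u : Euc p} (hu : u ∈ dom f) (k : ℕ) :
    ∀ v ∈ dom (conj g),
      realLagrangian f g K (x (k + 1)) v - betaSeq β₀ τ k / 2 * ‖v - ydot‖ ^ 2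
        - realLagrangian f g K u (ytil (k + 1))
        + LSeq K 0 β₀ τ k * τ k ^ 2 / 2 * ‖u - xtil τ x (k + 1)‖ ^ 2 ≤
      LSeq K 0 β₀ τ k * τ k ^ 2 / 2 * ‖x 0 - u‖ ^ 2 := by
  have hg' := hg.conj ⟨_, h.ytil_zero_mem⟩
  have step : ∀ k, ∀ v ∈ dom (conj g),
      realLagrangian f g K (x (k + 1)) v - betaSeq β₀ τ k / 2 * ‖v - ydot‖ ^ 2
        - realLagrangian f g K u (ytil (k + 1))
        + LSeq K 0 β₀ τ k * τ k ^ 2 / 2 * ‖u - xtil τ x (k + 1)‖ ^ 2 ≤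
      (1 - τ k) * (realLagrangian f g K (x k) (y (k + 1))
        - (1 + τ k) * betaSeq β₀ τ k / 2 * ‖y (k + 1) - ydot‖ ^ 2
        - realLagrangian f g K u (ytil k))
        + LSeq K 0 β₀ τ k * τ k ^ 2 / 2 * ‖u - xtil τ x k‖ ^ 2 := by
    intro k v hv
    have hβk := betaSeq_pos hβ hτ k
    have hLk := LSeq_pos hK hβ hτ k
    have hxh := h.xhat_eq hK hβ hτ k
    have := accelerated_step hf.convexOn hg'.convexOn hβk (LSeq_zero_eq (K := K) k) (hτ.pos k)
      (hτ.le_one k) (xt := xtil τ x k) (ydot := ydot) hu (h.x_mem k) (x_succ_eq_xtil hτ x k) hv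
      (h.y_succ k).1 (h.ytil_mem hg hτ k) ?_ ?_
    · rw [← h.ytil_succ] at this
      unfold realLagrangian
      linarith
    · intro w hw
      have := (h.y_succ k).subgradient hg' (by positivity) hw
      have e : (1 / (1 / betaSeq β₀ τ k)) •
          (ydot + (1 / betaSeq β₀ τ k) • K (xhat k) - y (k + 1)) =
          betaSeq β₀ τ k • (ydot - y (k + 1)) + K (xhat k) := by
        rw [one_div_one_div, add_sub_right_comm, smul_add, smul_smul,
          mul_one_div_cancel hβk.ne', one_smul]
      rwa [e, hxh] at this
    · intro w hw
      have := (h.x_succ k).subgradient hf (by positivity) hw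
      have e : (1 / (1 / LSeq K 0 β₀ τ k)) •
          (xhat k - (1 / LSeq K 0 β₀ τ k) • K.adjoint (y (k + 1)) - x (k + 1)) =
          LSeq K 0 β₀ τ k • (xhat k - x (k + 1)) - K.adjoint (y (k + 1)) := by
        rw [one_div_one_div, sub_right_comm, smul_sub, smul_smul,
          mul_one_div_cancel hLk.ne', one_smul]
      rwa [e, hxh, inner_sub_left, real_inner_smul_left,
        ContinuousLinearMap.adjoint_inner_left] at this
  induction k with
  | zero =>
    intro v hv
    have := step 0 v hv
    rw [show xtil τ x 0 = x 0 from rfl, norm_sub_rev u (x 0)] at this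
    -- `τ_0 = 1` removes the previous gap, and with it `ỹ^0`.
    simp only [hτ.zero, sub_self, zero_mul, zero_add] at this ⊢
    exact this
  | succ k ih =>
    intro v hv
    have h1 := step (k + 1) v hv
    have h2 := mul_le_mul_of_nonneg_left (ih _ (h.y_succ (k + 1)).1)
      (sub_nonneg.2 (hτ.le_one (k + 1)))
    rw [← betaSeq_eq hτ] at h1
    rw [LSeq_mul_tau_sq_succ hβ hτ] at h1 ⊢
    linarith

theorem IsASGARDPlus.lagrangian_gap_le (hf : ProperClosedConvex f) (hg : ProperClosedConvex g)
    (hK : K ≠ 0) (hβ : 0 < β₀) (hτ : IsTauSeq τ)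
    (h : IsASGARDPlus f g K 0 0 β₀ τ ydot x xhat y ytil) {k : ℕ} (hk : 1 ≤ k) {u : Euc p}
    (hu : u ∈ dom f) {v : Euc n} (hv : v ∈ dom (conj g)) :
    realLagrangian f g K (x k) v - realLagrangian f g K u (ytil k) ≤
      ‖K‖ ^ 2 / (2 * β₀ * k) * ‖x 0 - u‖ ^ 2 + β₀ / (k + 1) * ‖v - ydot‖ ^ 2 := by
  -- The potential of index `k` controls the iterate `k + 1`, hence the denominators `k + 1` and `k
  -- + 2`.
  obtain ⟨k, rfl⟩ := Nat.exists_eq_add_of_le' hk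
  have h1 := h.potential_le hf hg hK hβ hτ hu k v hv
  have hL := LSeq_pos hK hβ hτ k
  have h2 : 0 ≤ LSeq K 0 β₀ τ k * τ k ^ 2 / 2 * ‖u - xtil τ x (k + 1)‖ ^ 2 := by positivity
  have h3 : LSeq K 0 β₀ τ k * τ k ^ 2 / 2 ≤ ‖K‖ ^ 2 / (2 * β₀ * (k + 1)) := by
    have := LSeq_mul_tau_sq_le hK hβ hτ k
    rw [le_div_iff₀ hβ] at this
    rw [le_div_iff₀ (by positivity)]
    linarith
  have h4 : betaSeq β₀ τ k / 2 ≤ β₀ / (k + 1 + 1) := by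
    have := betaSeq_le hβ hτ k
    rw [le_div_iff₀ (by positivity)]
    linarith
  have h5 := mul_le_mul_of_nonneg_right h3 (sq_nonneg ‖x 0 - u‖)
  have h6 := mul_le_mul_of_nonneg_right h4 (sq_nonneg ‖v - ydot‖)
  push_cast
  linarith

theorem IsASGARDPlus.gap_le (hf : ProperClosedConvex f) (hg : ProperClosedConvex g)
    (hK : K ≠ 0) (hβ : 0 < β₀) (hτ : IsTauSeq τ)
    (h : IsASGARDPlus f g K 0 0 β₀ τ ydot x xhat y ytil) {k : ℕ} (hk : 1 ≤ k)
    {X : Set (Euc p)} {Y : Set (Euc n)} (hXY : IsGapDomain f g K X Y) :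
    gap f g K X Y (x k) (ytil k) ≤
      ((‖K‖ ^ 2 / (2 * β₀ * k) : ℝ) : EReal) * (⨆ u ∈ X, ((‖x 0 - u‖ ^ 2 : ℝ) : EReal)) +
      ((β₀ / (k + 1) : ℝ) : EReal) * (⨆ v ∈ Y, ((‖v - ydot‖ ^ 2 : ℝ) : EReal)) := by
  refine iSup₂_le fun u hu => iSup₂_le fun v hv => ?_
  have hu' := hXY.subset_dom_left hu
  have hv' := hXY.subset_dom_right hv
  rw [lagrangian_eq_coe hf hg (h.x_mem k) hv', lagrangian_eq_coe hf hg hu' (h.ytil_mem hg hτ k),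
    ← EReal.coe_sub]
  refine (EReal.coe_le_coe_iff.2 (h.lagrangian_gap_le hf hg hK hβ hτ hk hu' hv')).trans ?_
  rw [EReal.coe_add, EReal.coe_mul, EReal.coe_mul]
  refine add_le_add (mul_le_mul_of_nonneg_left ?_ ?_) (mul_le_mul_of_nonneg_left ?_ ?_)
  · exact le_iSup₂ (f := fun u (_ : u ∈ X) => ((‖x 0 - u‖ ^ 2 : ℝ) : EReal)) u hu
  · exact EReal.coe_nonneg.2 (by positivity)
  · exact le_iSup₂ (f := fun v (_ : v ∈ Y) => ((‖v - ydot‖ ^ 2 : ℝ) : EReal)) v hv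
  · exact EReal.coe_nonneg.2 (by positivity)

theorem IsASGARDPlus.primal_residual_le (hf : ProperClosedConvex f) (hg : ProperClosedConvex g)
    (hK : K ≠ 0) (hβ : 0 < β₀) (hτ : IsTauSeq τ)
    (h : IsASGARDPlus f g K 0 0 β₀ τ ydot x xhat y ytil) {k : ℕ} (hk : 1 ≤ k)
    {M : ℝ} (hM : LipschitzOnDom M g) {xs : Euc p} {ys : Euc n}
    (hs : IsSaddlePoint f g K xs ys) :
    primal f g K (x k) - primalOpt f g K ≤
      ((‖K‖ ^ 2 / (2 * β₀ * k) * ‖x 0 - xs‖ ^ 2 + β₀ / (k + 1) * (‖ydot‖ + M) ^ 2 : ℝ) :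
        EReal) := by
  set R : ℝ := ‖K‖ ^ 2 / (2 * β₀ * k) * ‖x 0 - xs‖ ^ 2 + β₀ / (k + 1) * (‖ydot‖ + M) ^ 2 with hR
  have hgK : g (K (x k)) ≤
      ((R + realLagrangian f g K xs ys - (f (x k)).toReal : ℝ) : EReal) := by
    -- Only `‖v‖ ≤ M` matters, so `‖v - ydot‖ ≤ ‖ydot‖ + M` bounds the gap at `u = xs` uniformly in
    -- `v`.
    refine hg.le_of_forall_conj_le ⟨_, hs.mem_dom_right⟩ hM.norm_subgradient_le
      fun v hv hvM => ?_
    have h1 := h.lagrangian_gap_le hf hg hK hβ hτ hk hs.mem_dom_left hv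
    have h2 := hs.real_le_right hf hg (h.ytil_mem hg hτ k)
    have h3 : β₀ / (k + 1) * ‖v - ydot‖ ^ 2 ≤ β₀ / (k + 1) * (‖ydot‖ + M) ^ 2 := by
      gcongr
      linarith [norm_sub_le v ydot]
    rw [realLagrangian] at h1
    linarith
  refine EReal.sub_le_of_le_add ?_
  refine le_trans ?_ (add_le_add_right (hs.le_primalOpt hf hg) _)
  rw [primal, ← hf.coe_toReal (h.x_mem k), ← EReal.coe_add]
  refine (add_le_add_right hgK _).trans ?_
  rw [← EReal.coe_add, EReal.coe_le_coe_iff]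
  linarith

theorem IsASGARDPlus.dual_residual_le (hf : ProperClosedConvex f) (hg : ProperClosedConvex g)
    (hK : K ≠ 0) (hβ : 0 < β₀) (hτ : IsTauSeq τ)
    (h : IsASGARDPlus f g K 0 0 β₀ τ ydot x xhat y ytil) {k : ℕ} (hk : 1 ≤ k)
    {M : ℝ} (hM : LipschitzOnDom M (conj f)) {xs : Euc p} {ys : Euc n}
    (hs : IsSaddlePoint f g K xs ys) :
    dual f g K (ytil k) - dualOpt f g K ≤
      ((‖K‖ ^ 2 / (2 * β₀ * k) * (‖x 0‖ + M) ^ 2 + β₀ / (k + 1) * ‖ydot - ys‖ ^ 2 : ℝ) :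
        EReal) := by
  set R : ℝ := ‖K‖ ^ 2 / (2 * β₀ * k) * (‖x 0‖ + M) ^ 2 + β₀ / (k + 1) * ‖ydot - ys‖ ^ 2 with hR
  have hfK : conj f (-(K.adjoint (ytil k))) ≤
      ((R - realLagrangian f g K xs ys - (conj g (ytil k)).toReal : ℝ) : EReal) := by
    refine hf.conj_le_of_forall_le ⟨_, hs.mem_dom_conj_left hf hg⟩ hM.norm_subgradient_le
      fun u hu huM => ?_
    have h1 := h.lagrangian_gap_le hf hg hK hβ hτ hk hu hs.mem_dom_right
    have h2 := hs.real_le_left hf hg (h.x_mem k)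
    have h3 : ‖K‖ ^ 2 / (2 * β₀ * k) * ‖x 0 - u‖ ^ 2 ≤
        ‖K‖ ^ 2 / (2 * β₀ * k) * (‖x 0‖ + M) ^ 2 := by
      gcongr
      linarith [norm_sub_le (x 0) u]
    rw [norm_sub_rev ys ydot] at h1
    rw [real_inner_neg_adjoint]
    have h4 : realLagrangian f g K u (ytil k) =
      (f u).toReal + inner ℝ (K u) (ytil k) - (conj g (ytil k)).toReal := rfl
    linarith
  refine EReal.sub_le_of_le_add ?_
  -- Replacing the optimal value by the finite saddle value reduces the claim to real arithmetic.
  refine le_trans ?_ (add_le_add_right (hs.le_dualOpt hf hg) _)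
  rw [dual, ← hg.coe_toReal_conj (h.ytil_mem hg hτ k)]
  refine (add_le_add_left hfK _).trans ?_
  rw [← EReal.coe_add, ← EReal.coe_add, EReal.coe_le_coe_iff]
  linarith

end Convergence

end ASGARD

theorem theorem1 {p n : ℕ} (f : Euc p → EReal) (g : Euc n → EReal) (K : Euc p →L[ℝ] Euc n)
    (hf : ProperClosedConvex f) (hg : ProperClosedConvex g)
    (hsaddle : ∃ xs ys, IsSaddlePoint f g K xs ys)
    (hslater : (0 : Euc n) ∈ intrinsicInterior ℝ (dom g - K '' dom f))
    (hK : K ≠ 0) :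
    -- the parameters `τ_k` are well defined
    (∀ t ∈ Set.Ioc (0 : ℝ) 1, ∃! s : ℝ, s ∈ Set.Ioo (0 : ℝ) 1 ∧ cubic t s = 0) ∧
    ∀ (β₀ : ℝ) (_ : 0 < β₀) (τ : ℕ → ℝ) (_ : IsTauSeq τ)
      (ydot : Euc n) (x xhat : ℕ → Euc p) (y ytil : ℕ → Euc n)
      (_ : IsASGARDPlus f g K 0 0 β₀ τ ydot x xhat y ytil) (k : ℕ) (_ : 1 ≤ k),
      -- (a) the gap function
      (∀ (X : Set (Euc p)) (Y : Set (Euc n)), IsGapDomain f g K X Y →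
        gap f g K X Y (x k) (ytil k) ≤
          ((‖K‖ ^ 2 / (2 * β₀ * k) : ℝ) : EReal) * (⨆ u ∈ X, ((‖x 0 - u‖ ^ 2 : ℝ) : EReal)) +
          ((β₀ / (k + 1) : ℝ) : EReal) * (⨆ v ∈ Y, ((‖v - ydot‖ ^ 2 : ℝ) : EReal))) ∧
      -- (b) the primal residual
      (∀ Mg : ℝ, LipschitzOnDom Mg g → ∀ xs ys, IsSaddlePoint f g K xs ys →
        primal f g K (x k) - primalOpt f g K ≤
          ((‖K‖ ^ 2 / (2 * β₀ * k) * ‖x 0 - xs‖ ^ 2 +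
            β₀ / (k + 1) * (‖ydot‖ + Mg) ^ 2 : ℝ) : EReal)) ∧
      -- (c) the dual residual
      (∀ Mf : ℝ, LipschitzOnDom Mf (conj f) → ∀ xs ys, IsSaddlePoint f g K xs ys →
        dual f g K (ytil k) - dualOpt f g K ≤
          ((‖K‖ ^ 2 / (2 * β₀ * k) * (‖x 0‖ + Mf) ^ 2 +
            β₀ / (k + 1) * ‖ydot - ys‖ ^ 2 : ℝ) : EReal)) := by
  refine ⟨fun t ht => existsUnique_cubic_root ht, ?_⟩
  intro β₀ hβ τ hτ ydot x xhat y ytil h k hk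
  exact ⟨fun X Y hXY => h.gap_le hf hg hK hβ hτ hk hXY,
    fun Mg hM xs ys hs => h.primal_residual_le hf hg hK hβ hτ hk hM hs,
    fun Mf hM xs ys hs => h.dual_residual_le hf hg hK hβ hτ hk hM hs⟩
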